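/- Let $m,n,q$ be positive integers, $A\in\mathbb{R}^{m\times n}$, $b\in\mathbb{R}^m$, $P\in\mathbb{R}^{q\times n}$, and let $C\subseteq\mathbb{R}^q$ be a polyhedral convex cone ($C=\{y: Z^Ty\ge 0\}$ for some matrix $Z$) that is pointed ($C\cap -C=\{0\}$) and non-trivial ($C\ne\{0\}$). Assume that $S:=\{x\in\mathbb{R}^n: Ax\ge b\}$ is nonempty, and let $\mathcal{P}:=P[S]+C$ be the upper image of the linear vector optimization problem $\min_C Px$ subject to $Ax\ge b$. Fix $c=(c_1,\dots,c_q)^T$ in the relative interior of $C$ with $c_q=1$, and put $R:=\{\lambda c:\lambda\ge 0\}$ and $R^*:=\{v\in\mathbb{R}^q: v_1=\dots=v_{q-1}=0,\ v_q\ge 0\}$. With the polar cone $C^\circ:=\{w: w^Ty\le 0 \text{ for all } y\in C\}$, let $$\mathcal{D}:=\{(w_1,\dots,w_{q-1},b^Tu)^T:\ u\in\mathbb{R}^m,\ w\in\mathbb{R}^q,\ A^Tu=P^Tw,\ c^Tw=1,\ w\in -C^\circ,\ u\ge 0\}-R^*$$ be the lower image of the geometric dual problem, and let $$\varphi(y,w):=\sum_{i=1}^{q-1}y_iw_i+y_q\Bigl(1-\sum_{i=1}^{q-1}c_iw_i\Bigr)-w_q\qquad(y,w\in\mathbb{R}^q).$$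 A face of a convex set $B$ is a convex subset $F\subseteq B$ such that $y,z\in B$, $\lambda\in(0,1)$ and $\lambda y+(1-\lambda)z\in F$ imply $y,z\in F$; it is proper if $\emptyset\ne F\ne B$. A face $F$ of $\mathcal{P}$ is $R$-minimal if no point of $F$ lies in $\mathcal{P}+R\setminus\{0\}$; a face $F^*$ of $\mathcal{D}$ is $R^*$-maximal if no point of $F^*$ lies in $\mathcal{D}-R^*\setminus\{0\}$. Then the map $$\Psi(F^*):=\bigcap_{w\in F^*}\{y\in\mathcal{P}:\ \varphi(y,w)=0\}$$ is a bijection from the set of all $R^*$-maximal proper faces of $\mathcal{D}$ onto the set of all $R$-minimal proper faces of $\mathcal{P}$. It is inclusion-reversing, that is, $F_1^*\subseteq F_2^*\iff\Psi(F_1^*)\supseteq\Psi(F_2^*)$ for all $R^*$-maximal proper faces $F_1^*,F_2^*$ of $\mathcal{D}$. Its inverse is $$\Psi^{-1}(F)=\bigcap_{y\in F}\{w\in\mathcal{D}:\ \varphi(y,w)=0\},$$ and for every $R^*$-maximal proper face $F^*$ of $\mathcal{D}$ one has $\dim F^*+\dim\Psi(F^*)=q-1$. -/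

import Mathlib

open scoped Pointwise Matrix

namespace GeometricDuality

/-- The convex cone generated by a set: all `r • x` with `0 ≤ r` and `x` in the convex hull. -/
def coneHull {q : ℕ} (B : Set (Fin q → ℝ)) : Set (Fin q → ℝ) :=
  {y | ∃ r : ℝ, 0 ≤ r ∧ ∃ x ∈ convexHull ℝ B, y = r • x}

/-- `C` is a polyhedral convex cone: `C = {y | Zᵀ y ≥ 0}` for some matrix `Z`. -/
def IsPolyhedralCone {q : ℕ} (C : Set (Fin q → ℝ)) : Prop :=
  ∃ (r : ℕ) (Z : Matrix (Fin q) (Fin r) ℝ), C = {y | 0 ≤ Zᵀ *ᵥ y}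

/-- Pointedness: `C ∩ -C = {0}`. -/
def IsPointed {q : ℕ} (C : Set (Fin q → ℝ)) : Prop :=
  C ∩ -C = {0}

/-- The polar cone `C° = {w | wᵀ y ≤ 0 for all y ∈ C}`. -/
def polarCone {q : ℕ} (C : Set (Fin q → ℝ)) : Set (Fin q → ℝ) :=
  {w | ∀ y ∈ C, w ⬝ᵥ y ≤ 0}

/-- `y` is a `C`-minimal point of `B`. -/
def IsMinimalPoint {q : ℕ} (C B : Set (Fin q → ℝ)) (y : Fin q → ℝ) : Prop :=
  y ∈ B ∧ y ∉ B + C \ {0}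

/-- `y` is a `C`-maximal point of `B`: it is `(-C)`-minimal. -/
def IsMaximalPoint {q : ℕ} (C B : Set (Fin q → ℝ)) (y : Fin q → ℝ) : Prop :=
  IsMinimalPoint (-C) B y

/-- `F` is a face of `B`: a convex subset of `B` such that any two points of `B`, some strict
convex combination of which lies in `F`, both lie in `F`. -/
def IsFace {q : ℕ} (B F : Set (Fin q → ℝ)) : Prop :=
  Convex ℝ F ∧ IsExtreme ℝ B F

/-- A proper face: a face that is neither empty nor the whole set. -/
def IsProperFace {q : ℕ} (B F : Set (Fin q → ℝ)) : Prop :=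
  IsFace B F ∧ F.Nonempty ∧ F ≠ B

/-- The set of all `C`-minimal proper faces of `B`. -/
def minimalProperFaces {q : ℕ} (C B : Set (Fin q → ℝ)) : Set (Set (Fin q → ℝ)) :=
  {F | IsProperFace B F ∧ ∀ y ∈ F, IsMinimalPoint C B y}

/-- The set of all `C`-maximal proper faces of `B`. -/
def maximalProperFaces {q : ℕ} (C B : Set (Fin q → ℝ)) : Set (Set (Fin q → ℝ)) :=
  {F | IsProperFace B F ∧ ∀ y ∈ F, IsMaximalPoint C B y}

/-- The dimension of a (nonempty) convex set: the dimension of its affine hull. -/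
noncomputable def dim {q : ℕ} (B : Set (Fin q → ℝ)) : ℕ :=
  Module.finrank ℝ (affineSpan ℝ B).direction

/-- The feasible set `S = {x | A x ≥ b}`. -/
def feasibleSet {m n : ℕ} (A : Matrix (Fin m) (Fin n) ℝ) (b : Fin m → ℝ) : Set (Fin n → ℝ) :=
  {x | b ≤ A *ᵥ x}

/-- The upper image `P[S] + C` of the problem `min_C P x` subject to `A x ≥ b`. -/
def upperImage {m n q : ℕ} (A : Matrix (Fin m) (Fin n) ℝ) (b : Fin m → ℝ)
    (P : Matrix (Fin q) (Fin n) ℝ) (C : Set (Fin q → ℝ)) : Set (Fin q → ℝ) :=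
  (fun x => P *ᵥ x) '' feasibleSet A b + C

/-- The feasible set of the geometric dual problem: all `(u, w)` with
`Aᵀ u = Pᵀ w`, `cᵀ w = 1`, `w ∈ -C°`, `u ≥ 0`. -/
def dualFeasibleSet {m n q : ℕ} (A : Matrix (Fin m) (Fin n) ℝ)
    (P : Matrix (Fin q) (Fin n) ℝ) (C : Set (Fin q → ℝ)) (c : Fin q → ℝ) :
    Set ((Fin m → ℝ) × (Fin q → ℝ)) :=
  {uw | Aᵀ *ᵥ uw.1 = Pᵀ *ᵥ uw.2 ∧ c ⬝ᵥ uw.2 = 1 ∧ uw.2 ∈ -polarCone C ∧ 0 ≤ uw.1}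

/-- The dual objective `D(u, w) = (w₁, …, w_{q-1}, bᵀ u)`, where `q = d + 1`. -/
def dualObjective {m d : ℕ} (b : Fin m → ℝ) (uw : (Fin m → ℝ) × (Fin (d + 1) → ℝ)) :
    Fin (d + 1) → ℝ :=
  Fin.snoc (α := fun _ => ℝ) (fun i : Fin d => uw.2 i.castSucc) (b ⬝ᵥ uw.1)

/-- The dual ordering cone `R* = {v | v₁ = … = v_{q-1} = 0, v_q ≥ 0}`, where `q = d + 1`. -/
def dualOrderingCone (d : ℕ) : Set (Fin (d + 1) → ℝ) :=
  {v | (∀ i : Fin d, v i.castSucc = 0) ∧ 0 ≤ v (Fin.last d)}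

/-- The lower image `D[T] - R*`, where `T` is the dual feasible set. -/
def lowerImage {m n d : ℕ} (A : Matrix (Fin m) (Fin n) ℝ) (b : Fin m → ℝ)
    (P : Matrix (Fin (d + 1)) (Fin n) ℝ) (C : Set (Fin (d + 1) → ℝ)) (c : Fin (d + 1) → ℝ) :
    Set (Fin (d + 1) → ℝ) :=
  dualObjective b '' dualFeasibleSet A P C c - dualOrderingCone d

/-- The bi-affine coupling function
`φ(y, w) = ∑_{i<q} yᵢ wᵢ + y_q (1 - ∑_{i<q} cᵢ wᵢ) - w_q`, where `q = d + 1`. -/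
def coupling {d : ℕ} (c y w : Fin (d + 1) → ℝ) : ℝ :=
  ∑ i : Fin d, y i.castSucc * w i.castSucc
    + y (Fin.last d) * (1 - ∑ i : Fin d, c i.castSucc * w i.castSucc) - w (Fin.last d)

/-- The duality map `Ψ(F*) = ⋂_{w ∈ F*} {y ∈ U | φ(y, w) = 0}`, with `U` the upper image. -/
def dualityMap {d : ℕ} (c : Fin (d + 1) → ℝ) (U Fs : Set (Fin (d + 1) → ℝ)) :
    Set (Fin (d + 1) → ℝ) :=
  ⋂ w ∈ Fs, {y | y ∈ U ∧ coupling c y w = 0}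

/-- The reverse map `F ↦ ⋂_{y ∈ F} {w ∈ L | φ(y, w) = 0}`, with `L` the lower image. -/
def inverseDualityMap {d : ℕ} (c : Fin (d + 1) → ℝ) (L F : Set (Fin (d + 1) → ℝ)) :
    Set (Fin (d + 1) → ℝ) :=
  ⋂ y ∈ F, {w | w ∈ L ∧ coupling c y w = 0}

end GeometricDuality

/-! As `w` varies, `φ(·, w)` runs through exactly the affine functions whose linear part equals 1 at
`c`. The roles are symmetric: `φ(y, ·)` runs through those whose linear part equals 1 at `-e_q`.
Linear programming duality (`affine_farkas`) identifies the lower image with the polar `{w | φ(·, w)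
≥ 0 on U}` of the upper image `U` (`lowerImage_eq_polar`). Since `U` is a polyhedron closed under
adding `R`, it is in turn the polar of the lower image when the latter is nonempty
(`Coupling.polar_polar`). The theorem is thus about a polar pair of polyhedra, and one half of it,
used for the coupling and for its flip, gives everything.

That half is `Coupling.conj_minimalProperFace`. Take a point `y₀` of a minimal face `F` with the
fewest active constraints. No active constraint decreases along `e`, and minimality makes one of
them strictly increase. Nonnegative combinations of active constraints, normalised at `e`, are
therefore points of the polar whose coupling vanishes on `F`. With all weights positive, the
coupling vanishes on no other point of `U`, so `F` is recovered. Perturbing these weights gives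
every direction of the conjugate face. Those directions form the annihilator of a space of
functionals of dimension `dim F + 1`, whence the dimension formula. -/

namespace GeometricDuality

/-- A set cut out by finitely many affine inequalities. -/
def IsPolyhedron {E : Type*} [AddCommGroup E] [Module ℝ E] (S : Set E) : Prop :=
  ∃ s : Set (Module.Dual ℝ E × ℝ), s.Finite ∧ S = {x | ∀ p ∈ s, p.2 ≤ p.1 x}

/-! ### Polyhedra, projections and Farkas' lemma -/

section Polyhedron

variable {E F : Type*} [AddCommGroup E] [Module ℝ E] [AddCommGroup F] [Module ℝ F]

theorem IsPolyhedron.exists_system {E : Type} [AddCommGroup E] [Module ℝ E] {S : Set E}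
    (hS : IsPolyhedron S) : ∃ (ι : Type) (_ : Fintype ι) (z : ι → Module.Dual ℝ E) (β : ι → ℝ),
      S = {x | ∀ i, β i ≤ z i x} := by
  obtain ⟨s, hs, rfl⟩ := hS
  exact ⟨s, hs.fintype, fun p => p.1.1, fun p => p.1.2, by ext; simp⟩

theorem IsPolyhedron.halfspace (f : Module.Dual ℝ E) (r : ℝ) : IsPolyhedron {x | r ≤ f x} :=
  ⟨{(f, r)}, Set.finite_singleton _, by simp⟩

theorem IsPolyhedron.inter {S T : Set E} (hS : IsPolyhedron S) (hT : IsPolyhedron T) :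
    IsPolyhedron (S ∩ T) := by
  obtain ⟨s, hs, rfl⟩ := hS
  obtain ⟨t, ht, rfl⟩ := hT
  refine ⟨s ∪ t, hs.union ht, ?_⟩
  ext x
  simp only [Set.mem_inter_iff, Set.mem_ofPred_eq, Set.mem_union, or_imp, forall_and]

theorem IsPolyhedron.iInter {ι : Type*} [Finite ι] {S : ι → Set E}
    (hS : ∀ i, IsPolyhedron (S i)) : IsPolyhedron {x | ∀ i, x ∈ S i} := by
  choose s hs h using hS
  refine ⟨⋃ i, s i, Set.finite_iUnion hs, ?_⟩
  ext x
  simp only [h, Set.mem_ofPred_eq, Set.mem_iUnion]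
  exact ⟨fun H p ⟨i, hi⟩ => H i p hi, fun H i p hp => H p ⟨i, hp⟩⟩

theorem IsPolyhedron.preimage {S : Set F} (hS : IsPolyhedron S) (f : E →ₗ[ℝ] F) (a : F) :
    IsPolyhedron {x | f x + a ∈ S} := by
  obtain ⟨s, hs, rfl⟩ := hS
  refine ⟨(fun p : Module.Dual ℝ F × ℝ => (p.1 ∘ₗ f, p.2 - p.1 a)) '' s, hs.image _, ?_⟩
  ext x
  simp only [Set.mem_ofPred_eq, Set.forall_mem_image, map_add, LinearMap.comp_apply,
    sub_le_iff_le_add]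

theorem IsPolyhedron.preimage_linear {S : Set F} (hS : IsPolyhedron S) (f : E →ₗ[ℝ] F) :
    IsPolyhedron (f ⁻¹' S) := by
  simpa [Set.preimage] using hS.preimage f 0

theorem exists_between_of_finite {α : Type*} {s t : Set α} (hs : s.Finite) (ht : t.Finite)
    (l u : α → ℝ) (h : ∀ p ∈ s, ∀ q ∈ t, l p ≤ u q) :
    ∃ r, (∀ p ∈ s, l p ≤ r) ∧ ∀ q ∈ t, r ≤ u q := by
  rcases s.eq_empty_or_nonempty with rfl | hne
  · rcases t.eq_empty_or_nonempty with rfl | hne'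
    · exact ⟨0, by simp, by simp⟩
    · obtain ⟨q, -, hq⟩ := Set.exists_min_image t u ht hne'
      exact ⟨u q, by simp, hq⟩
  · obtain ⟨p, hps, hp⟩ := Set.exists_max_image s l hs hne
    exact ⟨l p, hp, h p hps⟩

/-- Fourier–Motzkin elimination of one variable. -/
theorem IsPolyhedron.exists_real {S : Set (E × ℝ)} (hS : IsPolyhedron S) :
    IsPolyhedron {x | ∃ t, (x, t) ∈ S} := by
  obtain ⟨s, hs, rfl⟩ := hS
  let a : Module.Dual ℝ (E × ℝ) × ℝ → Module.Dual ℝ E := fun p => p.1 ∘ₗ LinearMap.inl ℝ E ℝ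
  let k : Module.Dual ℝ (E × ℝ) × ℝ → ℝ := fun p => p.1 (0, 1)
  have hsplit : ∀ p x t, p.1 (x, t) = a p x + k p * t := by
    intro p x t
    have : ((x, t) : E × ℝ) = (x, 0) + t • (0, 1) := by simp
    rw [this, map_add, map_smul]
    simp [a, k, mul_comm]
  -- Keep the constraints free of `t`. Each lower bound on `t` (`k p > 0`) is paired with each upper
  -- bound (`k q < 0`) by the positive combination that cancels `t`.
  refine ⟨(fun p => (a p, p.2)) '' {p ∈ s | k p = 0} ∪
    Set.image2 (fun p q => (k p • a q - k q • a p, k p * q.2 - k q * p.2))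
      {p ∈ s | 0 < k p} {q ∈ s | k q < 0},
    ((hs.subset (Set.sep_subset _ _)).image _).union
      ((hs.subset (Set.sep_subset _ _)).image2 _ (hs.subset (Set.sep_subset _ _))), ?_⟩
  ext x
  simp only [Set.mem_ofPred_eq, Set.mem_union, Set.mem_image, Set.mem_image2]
  constructor
  · rintro ⟨t, ht⟩ p (⟨p, ⟨hp, hk⟩, rfl⟩ | ⟨p, ⟨hp, hkp⟩, q, ⟨hq, hkq⟩, rfl⟩)
    · have := ht p hp
      rw [hsplit, hk] at this
      simpa using this
    · have h1 := ht p hp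
      have h2 := ht q hq
      rw [hsplit] at h1 h2
      simp only [LinearMap.sub_apply, LinearMap.smul_apply, smul_eq_mul]
      nlinarith
  · intro H
    obtain ⟨t, ht1, ht2⟩ := exists_between_of_finite
      (s := {p ∈ s | 0 < k p}) (t := {p ∈ s | k p < 0})
      (hs.subset (Set.sep_subset _ _)) (hs.subset (Set.sep_subset _ _))
      (fun p => (p.2 - a p x) / k p) (fun p => (p.2 - a p x) / k p) (by
        rintro p ⟨hp, hkp⟩ q ⟨hq, hkq⟩
        have := H _ (Or.inr ⟨p, ⟨hp, hkp⟩, q, ⟨hq, hkq⟩, rfl⟩)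
        simp only [LinearMap.sub_apply, LinearMap.smul_apply, smul_eq_mul] at this
        rw [div_le_iff₀ hkp, div_mul_eq_mul_div, le_div_iff_of_neg hkq]
        nlinarith)
    refine ⟨t, fun p hp => ?_⟩
    rw [hsplit]
    rcases lt_trichotomy (k p) 0 with h | h | h
    · have := ht2 p ⟨hp, h⟩
      rw [le_div_iff_of_neg h] at this
      linarith
    · have := H _ (Or.inl ⟨p, ⟨hp, h⟩, rfl⟩)
      simpa [h] using this
    · have := ht1 p ⟨hp, h⟩
      rw [div_le_iff₀ h] at this
      linarith

theorem IsPolyhedron.exists_fin {k : ℕ} {S : Set (E × (Fin k → ℝ))} (hS : IsPolyhedron S) :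
    IsPolyhedron {x | ∃ t, (x, t) ∈ S} := by
  induction k with
  | zero =>
    convert hS.preimage_linear (LinearMap.inl ℝ E (Fin 0 → ℝ)) using 1
    ext x
    simp only [Set.mem_ofPred_eq, Set.mem_preimage, LinearMap.inl_apply]
    exact ⟨fun ⟨t, ht⟩ => by rwa [Subsingleton.elim 0 t], fun h => ⟨0, h⟩⟩
  | succ k ih =>
    let f : (E × (Fin k → ℝ)) × ℝ →ₗ[ℝ] E × (Fin (k + 1) → ℝ) :=
      (LinearMap.fst ℝ E _ ∘ₗ LinearMap.fst ℝ _ ℝ).prod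
        (LinearMap.pi (Fin.cases (LinearMap.snd ℝ _ ℝ)
          fun i => LinearMap.proj i ∘ₗ LinearMap.snd ℝ E _ ∘ₗ LinearMap.fst ℝ _ ℝ))
    have hf : ∀ x t r, f ((x, t), r) = (x, Fin.cons r t) := by
      intro x t r
      refine Prod.ext rfl (funext fun i => ?_)
      refine Fin.cases ?_ (fun i => ?_) i <;> rfl
    convert ih (hS.preimage_linear f).exists_real using 1
    ext x
    simp only [Set.mem_ofPred_eq, Set.mem_preimage, hf]
    exact ⟨fun ⟨t, ht⟩ => ⟨Fin.tail t, t 0, by rwa [Fin.cons_self_tail]⟩,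
      fun ⟨t, r, h⟩ => ⟨_, h⟩⟩

theorem IsPolyhedron.exists_pi {ι : Type*} [Finite ι] {S : Set (E × (ι → ℝ))}
    (hS : IsPolyhedron S) : IsPolyhedron {x | ∃ t, (x, t) ∈ S} := by
  obtain ⟨k, ⟨e⟩⟩ := Finite.exists_equiv_fin ι
  convert (hS.preimage_linear ((LinearEquiv.refl ℝ E).prodCongr
    (LinearEquiv.funCongrLeft ℝ ℝ e)).toLinearMap).exists_fin using 1
  ext x
  refine ⟨fun ⟨t, ht⟩ => ⟨t ∘ e.symm, ?_⟩, fun ⟨t, ht⟩ => ⟨_, ht⟩⟩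
  have : ((LinearEquiv.refl ℝ E).prodCongr (LinearEquiv.funCongrLeft ℝ ℝ e))
      (x, t ∘ e.symm) = (x, t) := by
    refine Prod.ext rfl (funext fun i => ?_)
    simp [LinearEquiv.funCongrLeft_apply, LinearMap.funLeft]
  simpa only [Set.mem_preimage, LinearEquiv.coe_coe, this] using ht

theorem IsPolyhedron.eq {f : E →ₗ[ℝ] F} [FiniteDimensional ℝ F] (a : F) :
    IsPolyhedron {x | f x = a} := by
  let b := Module.finBasis ℝ F
  convert (IsPolyhedron.iInter (fun i => IsPolyhedron.halfspace (b.coord i ∘ₗ f) (b.coord i a))).inter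
    (IsPolyhedron.iInter (fun i => IsPolyhedron.halfspace (-(b.coord i ∘ₗ f)) (-(b.coord i a))))
    using 1
  ext x
  simp only [Set.mem_inter_iff, Set.mem_ofPred_eq, LinearMap.neg_apply, neg_le_neg_iff,
    LinearMap.comp_apply]
  constructor
  · rintro rfl
    simp
  · rintro ⟨h1, h2⟩
    exact b.ext_elem fun i => le_antisymm (h2 i) (h1 i)

/-- **Farkas' lemma** for linear functionals on a finite-dimensional space. -/
theorem farkas [FiniteDimensional ℝ E] {ι : Type*} [Fintype ι] (z : ι → Module.Dual ℝ E)
    (w : Module.Dual ℝ E) (h : ∀ y, (∀ i, 0 ≤ z i y) → 0 ≤ w y) :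
    ∃ t : ι → ℝ, 0 ≤ t ∧ ∑ i, t i • z i = w := by
  classical
  -- The cone generated by the `z i` is a projection of a polyhedron, hence itself given by finitely
  -- many inequalities. It suffices to check each of these at `w`.
  let f : Module.Dual ℝ E × (ι → ℝ) →ₗ[ℝ] Module.Dual ℝ E :=
    (Fintype.linearCombination ℝ z) ∘ₗ LinearMap.snd ℝ _ (ι → ℝ) - LinearMap.fst ℝ _ (ι → ℝ)
  have hQ : IsPolyhedron {w | ∃ t : ι → ℝ, (w, t) ∈
      {p : Module.Dual ℝ E × (ι → ℝ) | ∀ i, p ∈ {p | 0 ≤ p.2 i}} ∩ {p | f p = 0}} := by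
    refine IsPolyhedron.exists_pi (IsPolyhedron.inter (IsPolyhedron.iInter fun i => ?_)
      (IsPolyhedron.eq 0))
    exact IsPolyhedron.halfspace (E := Module.Dual ℝ E × (ι → ℝ))
      (LinearMap.proj i ∘ₗ LinearMap.snd ℝ (Module.Dual ℝ E) (ι → ℝ)) 0
  have hmem : ∀ w, w ∈ {w | ∃ t : ι → ℝ, (w, t) ∈
      {p : Module.Dual ℝ E × (ι → ℝ) | ∀ i, p ∈ {p | 0 ≤ p.2 i}} ∩ {p | f p = 0}} ↔
      ∃ t : ι → ℝ, 0 ≤ t ∧ ∑ i, t i • z i = w := by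
    intro w
    simp [f, Fintype.linearCombination_apply, sub_eq_zero, Pi.le_def]
  obtain ⟨s, -, hs⟩ := hQ
  rw [← hmem, hs]
  rw [hs] at hmem
  intro p hp
  have h0 : p.2 ≤ 0 := by
    simpa using (hmem 0).2 ⟨0, le_rfl, by simp⟩ p hp
  -- By reflexivity the inequality is evaluation at some `y`. If `z i y < 0`, the multiple of `z i`
  -- taking the value `p.2 - 1` at `y` would lie in the cone and violate it.
  obtain ⟨y, hy⟩ := (Module.evalEquiv ℝ E).surjective p.1
  refine h0.trans ?_
  rw [← hy]
  refine h y fun i => ?_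
  by_contra! hneg
  have := (hmem (((p.2 - 1) / z i y) • z i)).2 ⟨Pi.single i ((p.2 - 1) / z i y),
    Pi.single_nonneg.2 (div_nonneg_of_nonpos (by linarith) hneg.le), by
      rw [Finset.sum_eq_single i (fun j _ hj => by simp [hj]) (by simp)]
      simp⟩ p hp
  rw [map_smul, ← hy, smul_eq_mul, Module.evalEquiv_apply, Module.Dual.eval_apply,
    div_mul_cancel₀ _ hneg.ne] at this
  linarith

/-- The affine form of Farkas' lemma. -/
theorem affine_farkas [FiniteDimensional ℝ E] {ι : Type*} [Fintype ι] (z : ι → Module.Dual ℝ E)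
    (β : ι → ℝ) (w : Module.Dual ℝ E) (γ : ℝ) {x₀ : E} (hx₀ : ∀ i, β i ≤ z i x₀)
    (h : ∀ x, (∀ i, β i ≤ z i x) → γ ≤ w x) :
    ∃ t : ι → ℝ, 0 ≤ t ∧ ∑ i, t i • z i = w ∧ γ ≤ ∑ i, t i * β i := by
  -- Homogenisation with a variable `τ ≥ 0`, the constraint indexed by `none`; its multiplier is the
  -- slack in the final inequality. Points with `τ > 0` rescale to feasible points; those with `τ =
  -- 0` are recession directions, tested from `x₀`.
  let Z : Option ι → Module.Dual ℝ (E × ℝ) := fun o => o.elim (LinearMap.snd ℝ E ℝ)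
    fun i => (z i).coprod (-(β i) • LinearMap.id)
  obtain ⟨t, ht, hsum⟩ := farkas Z (w.coprod (-γ • LinearMap.id)) (by
    rintro ⟨x, τ⟩ hx
    have hτ : 0 ≤ τ := hx none
    have hx : ∀ i, β i * τ ≤ z i x := fun i => by
      have := hx (some i)
      simp [Z] at this
      linarith
    simp only [LinearMap.coprod_apply, LinearMap.smul_apply, LinearMap.id_apply, smul_eq_mul]
    rcases hτ.eq_or_lt with rfl | hτ
    · simp only [mul_zero, add_zero] at hx ⊢
      by_contra! hneg
      have hs : 0 ≤ max 0 ((γ - w x₀ - 1) / w x) := le_max_left _ _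
      have h1 := h (x₀ + (max 0 ((γ - w x₀ - 1) / w x)) • x) fun i => by
        rw [map_add, map_smul, smul_eq_mul]
        nlinarith [hx₀ i, mul_nonneg hs (hx i)]
      have h2 := (div_le_iff_of_neg hneg).1 (le_max_right 0 ((γ - w x₀ - 1) / w x))
      rw [map_add, map_smul, smul_eq_mul] at h1
      linarith
    · have h1 := h (τ⁻¹ • x) fun i => by
        rw [map_smul, smul_eq_mul, inv_mul_eq_div, le_div_iff₀ hτ]
        exact hx i
      rw [map_smul, smul_eq_mul, inv_mul_eq_div, le_div_iff₀ hτ] at h1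
      linarith)
  refine ⟨fun i => t (some i), fun i => ht _, ?_, ?_⟩
  · ext x
    have := LinearMap.congr_fun hsum (x, 0)
    simpa [Z, Fintype.sum_option] using this
  · have := LinearMap.congr_fun hsum (0, 1)
    simp [Z, Fintype.sum_option] at this
    have h0 := ht none
    simp only [Pi.zero_apply] at h0
    linarith

end Polyhedron

end GeometricDuality

namespace GeometricDuality

/-! ### Minimality along a ray and faces of polyhedra -/

section Faces

variable {q : ℕ} {ι : Type*} [Finite ι] {z : ι → Module.Dual ℝ (Fin q → ℝ)} {β : ι → ℝ}
  {F : Set (Fin q → ℝ)}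

theorem mem_coneHull_singleton {e x : Fin q → ℝ} :
    x ∈ coneHull {e} ↔ ∃ r : ℝ, 0 ≤ r ∧ x = r • e := by
  simp [coneHull]

theorem isMinimalPoint_ray_iff {e : Fin q → ℝ} (he : e ≠ 0) {U : Set (Fin q → ℝ)}
    {y : Fin q → ℝ} :
    IsMinimalPoint (coneHull {e}) U y ↔ y ∈ U ∧ ∀ t : ℝ, 0 < t → y - t • e ∉ U := by
  refine and_congr_right fun _ => ⟨fun h t ht hU => h ?_, ?_⟩
  · exact Set.mem_add.2 ⟨_, hU, t • e, ⟨mem_coneHull_singleton.2 ⟨t, ht.le, rfl⟩,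
      fun h0 => (smul_ne_zero ht.ne' he) h0⟩, by simp⟩
  · rintro h ⟨x, hx, k, ⟨hk, hk0⟩, rfl⟩
    obtain ⟨r, hr, rfl⟩ := mem_coneHull_singleton.1 hk
    rcases hr.eq_or_lt with rfl | hr
    · simp at hk0
    · exact h r hr (by simpa using hx)

/-- From a point of a polyhedron one can move a little in every direction that does not decrease
the constraints active at that point. -/
theorem exists_pos_add_smul_mem {y h : Fin q → ℝ} (hy : ∀ i, β i ≤ z i y)
    (hh : ∀ i, z i y = β i → 0 ≤ z i h) :
    ∃ ε : ℝ, 0 < ε ∧ ∀ i, β i ≤ z i (y + ε • h) := by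
  have : ∀ᶠ ε : ℝ in nhdsWithin 0 (Set.Ioi 0), 0 < ε ∧ ∀ i, β i ≤ z i (y + ε • h) := by
    refine Filter.Eventually.and self_mem_nhdsWithin (Filter.eventually_all.2 fun i => ?_)
    rcases (hy i).eq_or_lt with h0 | h0
    · filter_upwards [self_mem_nhdsWithin] with ε hε
      rw [map_add, map_smul, smul_eq_mul]
      linarith [mul_nonneg (le_of_lt (Set.mem_Ioi.1 hε)) (hh i h0.symm)]
    · refine Filter.Eventually.filter_mono nhdsWithin_le_nhds ?_
      have hc : Continuous fun ε : ℝ => z i y + ε * z i h := by fun_prop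
      have := (hc.tendsto 0).eventually_const_lt (u := β i) (by simpa using h0)
      filter_upwards [this] with ε hε
      rw [map_add, map_smul, smul_eq_mul]
      exact hε.le
  exact this.exists

/-- A nonempty face of a polyhedron is cut out by the constraints active at one of its points. -/
theorem IsFace.exists_mem_iff (hF : IsFace {y | ∀ i, β i ≤ z i y} F) (hne : F.Nonempty) :
    ∃ y₀ ∈ F, ∀ y, y ∈ F ↔ (∀ i, β i ≤ z i y) ∧ ∀ i, z i y₀ = β i → z i y = β i := by
  -- Choose `y₀` with the fewest active constraints. A constraint active at the midpoint of `y₀` and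
  -- `y ∈ F` is active at both, so minimality makes every constraint active at `y₀` active at `y`.
  obtain ⟨y₀, hy₀, hmin⟩ := exists_minimalFor_of_wellFoundedLT (· ∈ F)
    (fun y => {i | z i y = β i}.ncard) hne
  have hsub : ∀ y ∈ F, ∀ i, β i ≤ z i y := fun y hy => hF.2.subset hy
  refine ⟨y₀, hy₀, fun y => ⟨fun hy => ⟨hsub y hy, fun i hi => ?_⟩, fun ⟨hy, hact⟩ => ?_⟩⟩
  · have hm : (1 / 2 : ℝ) • y₀ + (1 / 2 : ℝ) • y ∈ F :=
      hF.1 hy₀ hy (by norm_num) (by norm_num) (by norm_num)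
    have hmv : ∀ j, z j ((1 / 2 : ℝ) • y₀ + (1 / 2 : ℝ) • y) = 1 / 2 * z j y₀ + 1 / 2 * z j y :=
      fun j => by simp
    have hle : {i | z i ((1 / 2 : ℝ) • y₀ + (1 / 2 : ℝ) • y) = β i} ⊆ {i | z i y₀ = β i} := by
      intro j hj
      rw [Set.mem_ofPred_eq, hmv] at hj
      have := hsub _ hy₀ j
      have := hsub _ hy j
      simp only [Set.mem_ofPred_eq]
      linarith
    have heq := Set.eq_of_subset_of_ncard_le hle (hmin hm (Set.ncard_le_ncard hle))
    have : i ∈ {i | z i ((1 / 2 : ℝ) • y₀ + (1 / 2 : ℝ) • y) = β i} := by rw [heq]; exact hi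
    rw [Set.mem_ofPred_eq, hmv, hi] at this
    linarith
  -- The segment from `y` extends slightly beyond `y₀` inside the polyhedron, so `y₀` is interior to
  -- it and extremality puts `y` in `F`.
  · obtain ⟨ε, hε, hmem⟩ := exists_pos_add_smul_mem (h := y₀ - y) (hsub _ hy₀) fun i hi => by
      rw [map_sub, hi, hact i hi, sub_self]
    refine hF.2.left_mem_of_mem_openSegment hy hmem hy₀
      ⟨ε / (1 + ε), 1 / (1 + ε), by positivity, by positivity, by field_simp; ring, ?_⟩
    ext j
    simp only [Pi.add_apply, Pi.smul_apply, Pi.sub_apply, smul_eq_mul]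
    field_simp
    ring

/-- Constraints inactive at `y₀` leave room for small moves, so only the active ones restrict
directions. -/
theorem mem_direction_affineSpan_iff {y₀ : Fin q → ℝ} (hy₀ : y₀ ∈ F)
    (hF : ∀ y, y ∈ F ↔ (∀ i, β i ≤ z i y) ∧ ∀ i, z i y₀ = β i → z i y = β i)
    {h : Fin q → ℝ} :
    h ∈ (affineSpan ℝ F).direction ↔ ∀ i, z i y₀ = β i → z i h = 0 := by
  rw [direction_affineSpan]
  constructor
  · intro hh i hi
    have : vectorSpan ℝ F ≤ LinearMap.ker (z i) := by
      refine Submodule.span_le.2 ?_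
      rintro _ ⟨a, ha, b, hb, rfl⟩
      simp [((hF a).1 ha).2 i hi, ((hF b).1 hb).2 i hi]
    exact this hh
  · intro hh
    obtain ⟨ε, hε, hmem⟩ := exists_pos_add_smul_mem ((hF y₀).1 hy₀).1 fun i hi => (hh i hi).ge
    have hm : y₀ + ε • h ∈ F := (hF _).2 ⟨hmem, fun i hi => by simp [hi, hh i hi]⟩
    have := vsub_mem_vectorSpan ℝ hm hy₀
    simp only [vsub_eq_sub, add_sub_cancel_left] at this
    exact (Submodule.smul_mem_iff _ hε.ne').1 this

end Faces

/-! ### Abstract bi-affine couplings, polars and conjugate faces -/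

/-- A bi-affine coupling function `B y v + f y + g v` with increasing directions `e` and `e'`,
for which every normalised linear functional of one variable arises from a value of the
other one. -/
structure Coupling (d : ℕ) where
  B : (Fin (d + 1) → ℝ) →ₗ[ℝ] Module.Dual ℝ (Fin (d + 1) → ℝ)
  f : Module.Dual ℝ (Fin (d + 1) → ℝ)
  g : Module.Dual ℝ (Fin (d + 1) → ℝ)
  e : Fin (d + 1) → ℝ
  e' : Fin (d + 1) → ℝ
  B_left : ∀ v, B e v = 0
  B_right : ∀ y, B y e' = 0
  f_e : f e = 1
  g_e' : g e' = 1
  left_surj : ∀ l : Module.Dual ℝ (Fin (d + 1) → ℝ), l e = 1 → ∃ v, ∀ y, B y v + f y = l y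
  right_surj : ∀ l : Module.Dual ℝ (Fin (d + 1) → ℝ), l e' = 1 → ∃ y, ∀ v, B y v + g v = l v
  left_inj : ∀ y, (∀ v, B y v = 0) → ∃ r : ℝ, y = r • e
  right_inj : ∀ v, (∀ y, B y v = 0) → ∃ r : ℝ, v = r • e'

namespace Coupling

variable {d : ℕ} (K : Coupling d)

/-- The value of the coupling function. -/
def val (y v : Fin (d + 1) → ℝ) : ℝ := K.B y v + K.f y + K.g v

/-- The coupling with the two variables exchanged. -/
def flip : Coupling d where
  B := K.B.flip
  f := K.g
  g := K.f
  e := K.e'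
  e' := K.e
  B_left := K.B_right
  B_right := K.B_left
  f_e := K.g_e'
  g_e' := K.f_e
  left_surj := K.right_surj
  right_surj := K.left_surj
  left_inj := K.right_inj
  right_inj := K.left_inj

theorem flip_val (y v : Fin (d + 1) → ℝ) : K.flip.val v y = K.val y v := by
  simp only [val, flip, LinearMap.flip_apply]
  ring

theorem e_ne_zero : K.e ≠ 0 := fun h => by simpa [h] using K.f_e

theorem val_add_smul_e (y v : Fin (d + 1) → ℝ) (t : ℝ) :
    K.val (y + t • K.e) v = K.val y v + t := by
  simp only [val, map_add, map_smul, LinearMap.add_apply, LinearMap.smul_apply, K.B_left, K.f_e,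
    smul_eq_mul]
  ring

theorem val_add_smul_e' (y v : Fin (d + 1) → ℝ) (t : ℝ) :
    K.val y (v + t • K.e') = K.val y v + t := by
  have := K.flip.val_add_smul_e v y t
  rwa [flip_val, flip_val] at this

theorem val_combo (v y₁ y₂ : Fin (d + 1) → ℝ) {a b : ℝ} (hab : a + b = 1) :
    K.val (a • y₁ + b • y₂) v = a * K.val y₁ v + b * K.val y₂ v := by
  simp only [val, map_add, map_smul, LinearMap.add_apply, LinearMap.smul_apply, smul_eq_mul]
  linear_combination (-K.g v) * hab

theorem val_combo' (y v₁ v₂ : Fin (d + 1) → ℝ) {a b : ℝ} (hab : a + b = 1) :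
    K.val y (a • v₁ + b • v₂) = a * K.val y v₁ + b * K.val y v₂ := by
  simpa only [flip_val] using K.flip.val_combo y v₁ v₂ hab

/-- `left_surj` provides the linear part; a shift along `e'` then adjusts only the constant term. -/
theorem exists_val_eq (l : Module.Dual ℝ (Fin (d + 1) → ℝ)) (hl : l K.e = 1) (γ : ℝ) :
    ∃ v, ∀ y, K.val y v = l y - γ := by
  obtain ⟨v, hv⟩ := K.left_surj l hl
  refine ⟨v + (-γ - K.g v) • K.e', fun y => ?_⟩
  rw [val_add_smul_e', val, hv]
  ring

theorem eq_of_val_eq {v v' : Fin (d + 1) → ℝ} (h : ∀ y, K.val y v = K.val y v') : v = v' := by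
  have hg : K.g v = K.g v' := by simpa [val] using h 0
  obtain ⟨r, hr⟩ := K.right_inj (v - v') fun y => by
    have := h y
    simp only [val, hg] at this
    rw [map_sub]
    linarith
  have hr0 : r = 0 := by simpa [hg, K.g_e'] using (congrArg K.g hr).symm
  rwa [hr0, zero_smul, sub_eq_zero] at hr

/-- All `v` for which the coupling function is nonnegative on `U`. -/
def polar (U : Set (Fin (d + 1) → ℝ)) : Set (Fin (d + 1) → ℝ) := {v | ∀ y ∈ U, 0 ≤ K.val y v}

/-- The points of `L` for which the coupling function vanishes on `F`. -/
def conj (L F : Set (Fin (d + 1) → ℝ)) : Set (Fin (d + 1) → ℝ) :=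
  {v | v ∈ L ∧ ∀ y ∈ F, K.val y v = 0}

section OneSided

variable {ι : Type*} {z : ι → Module.Dual ℝ (Fin (d + 1) → ℝ)}
  {β : ι → ℝ} {F U : Set (Fin (d + 1) → ℝ)} {y₀ : Fin (d + 1) → ℝ}

/-- The coupling is nonnegative on the polar, so its zero set is a face. A step along `e'` stays in
the polar but makes the value positive, so the face is proper; a step back makes it negative, so its
points are minimal. -/
theorem conj_mem_minimalProperFaces (hFU : F ⊆ U) (hF : F.Nonempty)
    (hne : (K.conj (K.polar U) F).Nonempty) :
    K.conj (K.polar U) F ∈ minimalProperFaces (coneHull {K.e'}) (K.polar U) := by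
  obtain ⟨y₀, hy₀⟩ := hF
  refine ⟨⟨⟨?_, ⟨fun v hv => hv.1, ?_⟩⟩, hne, ?_⟩, ?_⟩
  · rintro v ⟨hv, hv0⟩ w ⟨hw, hw0⟩ a b ha hb hab
    refine ⟨fun y hy => ?_, fun y hy => ?_⟩
    · rw [K.val_combo' _ _ _ hab]
      exact add_nonneg (mul_nonneg ha (hv y hy)) (mul_nonneg hb (hw y hy))
    · rw [K.val_combo' _ _ _ hab, hv0 y hy, hw0 y hy]
      simp
  · rintro v hv w hw u ⟨-, hu⟩ ⟨a, b, ha, hb, hab, rfl⟩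
    refine ⟨hv, fun y hy => ?_⟩
    have h0 := hu y hy
    rw [K.val_combo' _ _ _ hab] at h0
    have h1 := mul_nonneg ha.le (hv y (hFU hy))
    have h2 := mul_nonneg hb.le (hw y (hFU hy))
    exact (mul_eq_zero.1 (by linarith : a * K.val y v = 0)).resolve_left ha.ne'
  · obtain ⟨v, hv, hv0⟩ := hne
    intro heq
    have hmem : v + (1 : ℝ) • K.e' ∈ K.polar U := fun y hy => by
      rw [val_add_smul_e']
      linarith [hv y hy]
    rw [← heq] at hmem
    have := hmem.2 y₀ hy₀
    rw [val_add_smul_e', hv0 y₀ hy₀] at this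
    norm_num at this
  · rintro v ⟨hv, hv0⟩
    refine (isMinimalPoint_ray_iff K.flip.e_ne_zero).2 ⟨hv, fun t ht hmem => ?_⟩
    have := hmem y₀ (hFU hy₀)
    rw [sub_eq_add_neg, ← neg_smul, show K.flip.e = K.e' from rfl, val_add_smul_e',
      hv0 y₀ hy₀] at this
    linarith

/-- Otherwise a small step along `-e` would respect all constraints, against minimality. -/
theorem exists_active_pos [Finite ι] (hU : U = {y | ∀ i, β i ≤ z i y}) (hy₀ : y₀ ∈ U)
    (hmin : ∀ t : ℝ, 0 < t → y₀ - t • K.e ∉ U) : ∃ i, z i y₀ = β i ∧ 0 < z i K.e := by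
  subst hU
  by_contra! H
  obtain ⟨ε, hε, h⟩ := exists_pos_add_smul_mem (h := -K.e) hy₀ fun i hi => by
    rw [map_neg]
    linarith [H i hi]
  exact hmin ε hε (by simpa [sub_eq_add_neg] using h)

theorem constraint_e_nonneg (hU : U = {y | ∀ i, β i ≤ z i y}) (hy₀ : y₀ ∈ U)
    (hrec : ∀ y ∈ U, ∀ t : ℝ, 0 ≤ t → y + t • K.e ∈ U) (i : ι) : 0 ≤ z i K.e := by
  by_contra! hneg
  have h0 : β i ≤ z i y₀ := by rw [hU] at hy₀; exact hy₀ i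
  have h1 := hrec y₀ hy₀ ((β i - z i y₀ - 1) / z i K.e)
    (div_nonneg_of_nonpos (by linarith) hneg.le)
  rw [hU] at h1
  have := h1 i
  rw [map_add, map_smul, smul_eq_mul, div_mul_cancel₀ _ hneg.ne] at this
  linarith

theorem polar_polar (hU : IsPolyhedron U) (hne : U.Nonempty)
    (hrec : ∀ y ∈ U, ∀ t : ℝ, 0 ≤ t → y + t • K.e ∈ U) (hL : (K.polar U).Nonempty) :
    K.flip.polar (K.polar U) = U := by
  refine Set.Subset.antisymm (fun y hy => ?_) fun y hy v hv => by
    rw [flip_val]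
    exact hv y hy
  obtain ⟨y₀, hy₀⟩ := hne
  obtain ⟨ι, _, z, β, hU⟩ := hU.exists_system
  rw [hU]
  intro i
  have hy : ∀ v ∈ K.polar U, 0 ≤ K.val y v := fun v hv => by
    rw [← flip_val]
    exact hy v hv
  by_contra! hlt
  have hUi : ∀ y ∈ U, β i ≤ z i y := fun y hy => by rw [hU] at hy; exact hy i
  -- A violated constraint with `z i e > 0` can be normalised to a point of the polar. If `z i e =
  -- 0` it cannot, and is instead added to a known `v₀` with a factor `t` that makes the value at
  -- `y` equal to `-1`.
  rcases (K.constraint_e_nonneg hU hy₀ hrec i).eq_or_lt with h0 | hpos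
  · obtain ⟨v₀, hv₀⟩ := hL
    have hpos := sub_pos.2 hlt
    set t : ℝ := (K.val y v₀ + 1) / (β i - z i y) with ht
    have ht0 : 0 ≤ t := div_nonneg (by linarith [hy v₀ hv₀]) hpos.le
    obtain ⟨v, hv⟩ := K.exists_val_eq (K.B.flip v₀ + K.f + t • z i)
      (by simp [K.B_left, K.f_e, ← h0]) (t * β i - K.g v₀)
    have hv' : ∀ y, K.val y v = K.val y v₀ + t * (z i y - β i) := fun y => by
      rw [hv]
      simp only [val, LinearMap.add_apply, LinearMap.flip_apply, LinearMap.smul_apply, smul_eq_mul]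
      ring
    have h1 := hy v fun y hy => by
      rw [hv']
      exact add_nonneg (hv₀ y hy) (mul_nonneg ht0 (sub_nonneg.2 (hUi y hy)))
    have h2 : t * (β i - z i y) = K.val y v₀ + 1 := div_mul_cancel₀ _ hpos.ne'
    rw [hv'] at h1
    linarith
  · obtain ⟨v, hv⟩ := K.exists_val_eq ((z i K.e)⁻¹ • z i) (by simp [hpos.ne'])
      ((z i K.e)⁻¹ * β i)
    have hinv := inv_pos.2 hpos
    have h1 := hy v fun y hy => by
      rw [hv, LinearMap.smul_apply, smul_eq_mul, ← mul_sub]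
      exact mul_nonneg hinv.le (sub_nonneg.2 (hUi y hy))
    rw [hv, LinearMap.smul_apply, smul_eq_mul, ← mul_sub] at h1
    linarith [mul_pos hinv (sub_pos.2 hlt)]

theorem exists_mem_conj_of_active [Fintype ι] (hU : U = {y | ∀ i, β i ≤ z i y})
    (hF : ∀ y, y ∈ F ↔ (∀ i, β i ≤ z i y) ∧ ∀ i, z i y₀ = β i → z i y = β i)
    (a : {i // z i y₀ = β i} → ℝ) (ha : ∀ i, 0 ≤ a i) (hsum : ∑ i, a i * z i K.e = 1) :
    ∃ v ∈ K.conj (K.polar U) F, ∀ y, K.val y v = ∑ i, a i * (z i y - β i) := by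
  obtain ⟨v, hv⟩ := K.exists_val_eq (∑ i, a i • z i.1) (by simpa using hsum) (∑ i, a i * β i)
  have hv' : ∀ y, K.val y v = ∑ i, a i * (z i y - β i) := fun y => by
    rw [hv]
    simp [mul_sub]
  refine ⟨v, ⟨fun y hy => ?_, fun y hy => ?_⟩, hv'⟩
  · rw [hv', hU] at *
    exact Finset.sum_nonneg fun i _ => mul_nonneg (ha i) (sub_nonneg.2 (hy i))
  · rw [hv']
    exact Finset.sum_eq_zero fun i _ => by rw [((hF y).1 hy).2 i i.2, sub_self, mul_zero]

/-- The dimension formula follows from the description of the two affine hulls. -/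
theorem finrank_add_finrank (N D : Submodule ℝ (Fin (d + 1) → ℝ)) (y₀ : Fin (d + 1) → ℝ)
    (hN : ∀ r : ℝ, r • K.e ∈ N → r = 0)
    (hD : ∀ h', h' ∈ D ↔ K.B y₀ h' + K.g h' = 0 ∧ ∀ h ∈ N, K.B h h' = 0) :
    Module.finrank ℝ N + Module.finrank ℝ D = d := by
  -- The range of `T` consists of the functionals that cut out `D`. Evaluation at `e'` gives `s = 0`
  -- on the kernel; then `h` is a multiple of `e`, hence zero by `hN`. So the range has dimension `1
  -- + dim N`.
  let T : ℝ × N →ₗ[ℝ] Module.Dual ℝ (Fin (d + 1) → ℝ) :=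
    (LinearMap.toSpanSingleton ℝ _ (K.B y₀ + K.g)).coprod (K.B ∘ₗ N.subtype)
  have hT : ∀ s h v, T (s, h) v = s * (K.B y₀ v + K.g v) + K.B h v := fun s h v => by
    simp [T, mul_add]
  have hinj : Function.Injective T := by
    rw [← LinearMap.ker_eq_bot, LinearMap.ker_eq_bot']
    rintro ⟨s, h⟩ h0
    have h1 : ∀ v, s * (K.B y₀ v + K.g v) + K.B h v = 0 := fun v => by rw [← hT, h0]; rfl
    have hs : s = 0 := by simpa [K.B_right, K.g_e'] using h1 K.e'
    subst hs
    obtain ⟨r, hr⟩ := K.left_inj h fun v => by simpa using h1 v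
    have : r = 0 := hN r (hr ▸ h.2)
    rw [this, zero_smul] at hr
    ext1
    · rfl
    · exact Subtype.ext hr
  have hDT : D = (LinearMap.range T).dualCoannihilator := by
    ext h'
    rw [hD, Submodule.mem_dualCoannihilator]
    constructor
    · rintro ⟨h1, h2⟩ _ ⟨⟨s, h⟩, rfl⟩
      rw [hT, h1, h2 h h.2]
      simp
    · intro H
      refine ⟨?_, fun h hh => ?_⟩
      · simpa [hT] using H _ ⟨(1, 0), rfl⟩
      · simpa [hT] using H _ ⟨(0, ⟨h, hh⟩), rfl⟩
  have h1 := Subspace.finrank_add_finrank_dualCoannihilator_eq (LinearMap.range T)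
  rw [← hDT, LinearMap.finrank_range_of_inj hinj] at h1
  simp at h1
  omega

/-- For the converse, `B · h'` vanishes wherever all active constraints do, so it is a combination
of them with coefficients `k`. The weights `a + ε k` remain nonnegative for small `ε`, and
normalised because `B e h' = 0`. They yield the point `v₀ + ε h'` of the conjugate face. -/
theorem mem_direction_conj_iff [Fintype ι] (hU : U = {y | ∀ i, β i ≤ z i y}) (hy₀ : y₀ ∈ F)
    (hF : ∀ y, y ∈ F ↔ (∀ i, β i ≤ z i y) ∧ ∀ i, z i y₀ = β i → z i y = β i)
    (a : {i // z i y₀ = β i} → ℝ) (ha : ∀ i, 0 < a i) (hsum : ∑ i, a i * z i K.e = 1)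
    {h' : Fin (d + 1) → ℝ} :
    h' ∈ (affineSpan ℝ (K.conj (K.polar U) F)).direction ↔
      K.B y₀ h' + K.g h' = 0 ∧ ∀ h ∈ (affineSpan ℝ F).direction, K.B h h' = 0 := by
  constructor
  · rw [direction_affineSpan]
    intro hh
    have hy : ∀ y ∈ F, K.B y h' + K.g h' = 0 := by
      intro y hy
      have : vectorSpan ℝ (K.conj (K.polar U) F) ≤ LinearMap.ker (K.B y + K.g) := by
        refine Submodule.span_le.2 ?_
        rintro _ ⟨v, hv, w, hw, rfl⟩
        have h1 := hv.2 y hy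
        have h2 := hw.2 y hy
        simp only [val] at h1 h2
        simp only [vsub_eq_sub, SetLike.mem_coe, LinearMap.mem_ker, map_sub, LinearMap.add_apply]
        linarith
      exact this hh
    refine ⟨hy y₀ hy₀, fun h hdir => ?_⟩
    rw [direction_affineSpan] at hdir
    have : vectorSpan ℝ F ≤ LinearMap.ker (K.B.flip h') := by
      refine Submodule.span_le.2 ?_
      rintro _ ⟨v, hv, w, hw, rfl⟩
      have h1 := hy v hv
      have h2 := hy w hw
      simp only [vsub_eq_sub, SetLike.mem_coe, LinearMap.mem_ker, map_sub, LinearMap.flip_apply]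
      linarith
    exact this hdir
  · rintro ⟨h0, hN⟩
    have hspan : K.B.flip h' ∈ Submodule.span ℝ
        (Set.range fun i : {i // z i y₀ = β i} => z i.1) := by
      refine mem_span_of_iInf_ker_le_ker fun h hh => hN h ?_
      rw [mem_direction_affineSpan_iff hy₀ hF]
      intro i hi
      exact (Submodule.mem_iInf _).1 hh ⟨i, hi⟩
    obtain ⟨k, hk⟩ := (Submodule.mem_span_range_iff_exists_fun ℝ).1 hspan
    have hk' : ∀ y, ∑ i, k i * z i.1 y = K.B y h' := fun y => by
      simpa using LinearMap.congr_fun hk y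
    have hε : ∀ᶠ ε : ℝ in nhdsWithin 0 (Set.Ioi 0), 0 < ε ∧ ∀ i, 0 ≤ a i + ε * k i := by
      refine Filter.Eventually.and self_mem_nhdsWithin (Filter.eventually_all.2 fun i => ?_)
      refine Filter.Eventually.filter_mono nhdsWithin_le_nhds ?_
      have hc : Continuous fun ε : ℝ => a i + ε * k i := by fun_prop
      exact ((hc.tendsto 0).eventually_const_lt (u := 0)
        (by simpa using ha i)).mono fun _ h => h.le
    obtain ⟨ε, hε, hpos⟩ := hε.exists
    obtain ⟨v₀, hv₀, hval₀⟩ := K.exists_mem_conj_of_active hU hF a (fun i => (ha i).le) hsum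
    obtain ⟨v₁, hv₁, hval₁⟩ := K.exists_mem_conj_of_active hU hF (fun i => a i + ε * k i) hpos (by
      simp only [add_mul, Finset.sum_add_distrib, hsum, mul_assoc, ← Finset.mul_sum, hk',
        K.B_left]
      simp)
    have heq : v₁ = v₀ + ε • h' := by
      refine K.eq_of_val_eq fun y => ?_
      have hβ : ∑ i, k i * β i.1 = K.B y₀ h' := by
        rw [← hk']
        exact Finset.sum_congr rfl fun i _ => by rw [i.2]
      have h1 : K.val y (v₀ + ε • h') = K.val y v₀ + ε * (K.B y h' + K.g h') := by
        simp only [val, map_add, map_smul, smul_eq_mul]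
        ring
      rw [h1, hval₁, hval₀]
      simp only [add_mul, Finset.sum_add_distrib, mul_assoc, ← Finset.mul_sum, mul_sub,
        Finset.sum_sub_distrib, hk', hβ]
      linear_combination (-ε) * h0
    have := vsub_mem_vectorSpan ℝ hv₁ hv₀
    rw [heq, vsub_eq_sub, add_sub_cancel_left] at this
    rw [direction_affineSpan]
    exact (Submodule.smul_mem_iff _ hε.ne').1 this

/-- Conjugation sends a minimal proper face of a polyhedron to a minimal proper face of its polar,
recovers the face and complements its dimension. -/
theorem conj_minimalProperFace (hU : IsPolyhedron U)
    (hrec : ∀ y ∈ U, ∀ t : ℝ, 0 ≤ t → y + t • K.e ∈ U)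
    (hF : F ∈ minimalProperFaces (coneHull {K.e}) U) :
    K.conj (K.polar U) F ∈ minimalProperFaces (coneHull {K.e'}) (K.polar U) ∧
      K.flip.conj U (K.conj (K.polar U) F) = F ∧
      dim F + dim (K.conj (K.polar U) F) = d := by
  classical
  obtain ⟨ι, _, z, β, hU⟩ := hU.exists_system
  obtain ⟨⟨hface, hne, -⟩, hmin⟩ := hF
  have hFU : F ⊆ U := hface.2.subset
  obtain ⟨y₀, hy₀, hF⟩ := IsFace.exists_mem_iff (hU ▸ hface) hne
  obtain ⟨-, hmin₀⟩ := (isMinimalPoint_ray_iff K.e_ne_zero).1 (hmin y₀ hy₀)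
  obtain ⟨i₀, hi₀, hpos₀⟩ := K.exists_active_pos hU (hFU hy₀) hmin₀
  have hnonneg := K.constraint_e_nonneg hU (hFU hy₀) hrec
  have hσ : 0 < ∑ i : {i // z i y₀ = β i}, z i K.e :=
    Finset.sum_pos' (fun i _ => hnonneg i) ⟨⟨i₀, hi₀⟩, Finset.mem_univ _, hpos₀⟩
  -- Equal weights suffice: positivity forces each active constraint to be tight wherever the
  -- combination vanishes on `U`.
  let a : {i // z i y₀ = β i} → ℝ := fun _ => (∑ i : {i // z i y₀ = β i}, z i K.e)⁻¹
  have ha : ∀ i, 0 < a i := fun _ => inv_pos.2 hσ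
  have hsum : ∑ i, a i * z i K.e = 1 := by
    rw [← Finset.mul_sum]
    exact inv_mul_cancel₀ hσ.ne'
  obtain ⟨v, hv, hval⟩ := K.exists_mem_conj_of_active hU hF a (fun i => (ha i).le) hsum
  refine ⟨K.conj_mem_minimalProperFaces hFU hne ⟨v, hv⟩, ?_, ?_⟩
  · refine Set.Subset.antisymm ?_ fun y hy => ⟨hFU hy, fun w hw => by
      rw [flip_val]
      exact hw.2 y hy⟩
    rintro y ⟨hy, hy0⟩
    have hyU : ∀ i, β i ≤ z i y := by rw [hU] at hy; exact hy
    refine (hF y).2 ⟨hyU, fun i hi => ?_⟩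
    have h0 := hy0 v hv
    rw [flip_val, hval, Finset.sum_eq_zero_iff_of_nonneg
      fun i _ => mul_nonneg (ha i).le (sub_nonneg.2 (hyU i))] at h0
    have := (mul_eq_zero.1 (h0 ⟨i, hi⟩ (Finset.mem_univ _))).resolve_left (ha ⟨i, hi⟩).ne'
    exact sub_eq_zero.1 this
  · refine K.finrank_add_finrank _ _ y₀ (fun r hr => ?_)
      fun h' => K.mem_direction_conj_iff hU hy₀ hF a ha hsum
    have := (mem_direction_affineSpan_iff hy₀ hF).1 hr i₀ hi₀
    rw [map_smul, smul_eq_mul] at this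
    exact (mul_eq_zero.1 this).resolve_right hpos₀.ne'

end OneSided

end Coupling

end GeometricDuality

/-! ### The geometric coupling, and the lower image as polar of the upper image -/

namespace GeometricDuality

theorem IsPolyhedron.le_pi {E ι : Type*} [AddCommGroup E] [Module ℝ E] [Finite ι]
    (f : E →ₗ[ℝ] ι → ℝ) (a : ι → ℝ) : IsPolyhedron {x | a ≤ f x} :=
  IsPolyhedron.iInter (S := fun i => {x | a i ≤ f x i}) fun i =>
    IsPolyhedron.halfspace (LinearMap.proj i ∘ₗ f) (a i)

theorem dual_apply_eq_sum {ι : Type*} [Fintype ι] [DecidableEq ι] (l : Module.Dual ℝ (ι → ℝ))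
    (y : ι → ℝ) : l y = ∑ i, y i * l (Pi.single i 1) := by
  conv_lhs => rw [pi_eq_sum_univ' y, map_sum]
  exact Finset.sum_congr rfl fun i _ => by rw [map_smul, smul_eq_mul]

/-- The coupling of the geometric duality theorem. -/
def geometricCoupling {d : ℕ} (c : Fin (d + 1) → ℝ) (hc : c (Fin.last d) = 1) : Coupling d where
  B := LinearMap.mk₂ ℝ
    -- The bilinear terms of `φ`, collected by the coordinates of `v`; the last coordinate of `v`
    -- does not enter.
    (fun y v => ∑ i : Fin d, (y i.castSucc - c i.castSucc * y (Fin.last d)) * v i.castSucc)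
    (fun y y' v => by
      rw [← Finset.sum_add_distrib]
      exact Finset.sum_congr rfl fun i _ => by simp only [Pi.add_apply]; ring)
    (fun r y v => by
      rw [smul_eq_mul, Finset.mul_sum]
      exact Finset.sum_congr rfl fun i _ => by simp only [Pi.smul_apply, smul_eq_mul]; ring)
    (fun y v v' => by
      rw [← Finset.sum_add_distrib]
      exact Finset.sum_congr rfl fun i _ => by simp only [Pi.add_apply]; ring)
    (fun r y v => by
      rw [smul_eq_mul, Finset.mul_sum]
      exact Finset.sum_congr rfl fun i _ => by simp only [Pi.smul_apply, smul_eq_mul]; ring)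
  f := LinearMap.proj (Fin.last d)
  g := -LinearMap.proj (Fin.last d)
  e := c
  e' := -Pi.single (Fin.last d) 1
  B_left v := by simp [hc]
  B_right y := by simp [Fin.castSucc_ne_last]
  f_e := by simp [hc]
  g_e' := by simp
  left_surj l hl := by
    refine ⟨fun j => l (Pi.single j 1), fun y => ?_⟩
    rw [dual_apply_eq_sum l, Fin.sum_univ_castSucc] at hl ⊢
    simp only [hc, one_mul] at hl
    simp only [LinearMap.mk₂_apply, LinearMap.proj_apply, sub_mul,
      Finset.sum_sub_distrib, mul_right_comm _ (y (Fin.last d)), ← Finset.sum_mul]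
    linear_combination (-y (Fin.last d)) * hl
  right_surj l hl := by
    have hlast : l (Pi.single (Fin.last d) 1) = -1 := by
      rw [map_neg] at hl
      linarith
    -- `y` matters only modulo `c`, so its last coordinate may be taken to be 0.
    refine ⟨Fin.snoc (α := fun _ => ℝ) (fun i : Fin d => l (Pi.single i.castSucc 1)) 0,
      fun v => ?_⟩
    rw [dual_apply_eq_sum l, Fin.sum_univ_castSucc, hlast]
    simp [mul_comm]
  left_inj y hy := by
    refine ⟨y (Fin.last d), funext fun j => ?_⟩
    refine Fin.lastCases (by simp [hc]) (fun i => ?_) j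
    have := hy (Pi.single i.castSucc 1)
    simp [Pi.single_apply] at this
    simp only [Pi.smul_apply, smul_eq_mul]
    linarith
  right_inj v hv := by
    refine ⟨-v (Fin.last d), funext fun j => ?_⟩
    refine Fin.lastCases (by simp) (fun i => ?_) j
    have := hv (Pi.single i.castSucc 1)
    simpa [Pi.single_apply, Fin.castSucc_ne_last, eq_comm] using this

theorem geometricCoupling_val {d : ℕ} (c : Fin (d + 1) → ℝ) (hc : c (Fin.last d) = 1)
    (y v : Fin (d + 1) → ℝ) : (geometricCoupling c hc).val y v = coupling c y v := by
  simp only [Coupling.val, geometricCoupling, coupling, LinearMap.mk₂_apply, LinearMap.neg_apply,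
    LinearMap.proj_apply, sub_mul, Finset.sum_sub_distrib, mul_right_comm _ (y (Fin.last d)),
    ← Finset.sum_mul]
  ring

/-- The normalised weight vector with the same first `d` coordinates as `v`. -/
def weight {d : ℕ} (c v : Fin (d + 1) → ℝ) : Fin (d + 1) → ℝ :=
  Fin.snoc (α := fun _ => ℝ) (fun i : Fin d => v i.castSucc)
    (1 - ∑ i : Fin d, c i.castSucc * v i.castSucc)

section Weight

variable {d : ℕ} {c : Fin (d + 1) → ℝ}

theorem coupling_eq_weight (y v : Fin (d + 1) → ℝ) :
    coupling c y v = weight c v ⬝ᵥ y - v (Fin.last d) := by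
  simp only [coupling, weight, dotProduct, Fin.sum_univ_castSucc, Fin.snoc_castSucc,
    Fin.snoc_last]
  simp only [mul_comm]

theorem dotProduct_weight (hc : c (Fin.last d) = 1) (v : Fin (d + 1) → ℝ) :
    c ⬝ᵥ weight c v = 1 := by
  simp [weight, dotProduct, Fin.sum_univ_castSucc, hc]

theorem eq_weight (hc : c (Fin.last d) = 1) {w v : Fin (d + 1) → ℝ} (hw : c ⬝ᵥ w = 1)
    (hwv : ∀ i : Fin d, w i.castSucc = v i.castSucc) : w = weight c v := by
  funext j
  simp only [dotProduct, Fin.sum_univ_castSucc, hc, one_mul] at hw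
  refine Fin.lastCases ?_ (fun i => ?_) j
  · simp only [weight, Fin.snoc_last, ← hwv]
    linarith
  · simp [weight, hwv]

/-- The normalisation `cᵀw = 1` determines `w` from its first `d` coordinates, and subtracting `R*`
relaxes the last coordinate to an inequality. -/
theorem mem_lowerImage_iff {m n : ℕ} {A : Matrix (Fin m) (Fin n) ℝ} {b : Fin m → ℝ}
    {P : Matrix (Fin (d + 1)) (Fin n) ℝ} {C : Set (Fin (d + 1) → ℝ)} (hc : c (Fin.last d) = 1)
    {v : Fin (d + 1) → ℝ} :
    v ∈ lowerImage A b P C c ↔ weight c v ∈ -polarCone C ∧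
      ∃ u : Fin m → ℝ, 0 ≤ u ∧ Aᵀ *ᵥ u = Pᵀ *ᵥ weight c v ∧ v (Fin.last d) ≤ b ⬝ᵥ u := by
  constructor
  · rintro ⟨_, ⟨⟨u, w⟩, ⟨h1, h2, h3, h4⟩, rfl⟩, k, ⟨hk, hk0⟩, rfl⟩
    have hw := eq_weight hc (v := dualObjective b (u, w) - k) h2 fun i => by
      simp [dualObjective, hk i]
    simp only at h1 h2 h3 h4
    simp only at hw
    rw [hw] at h1 h3
    refine ⟨h3, u, h4, h1, ?_⟩
    simpa [dualObjective] using hk0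
  · rintro ⟨h3, u, h4, h1, h5⟩
    refine ⟨_, ⟨(u, weight c v), ⟨h1, dotProduct_weight hc v, h3, h4⟩, rfl⟩,
      Pi.single (Fin.last d) (b ⬝ᵥ u - v (Fin.last d)), ⟨fun i => ?_, ?_⟩, ?_⟩
    · simp [Fin.castSucc_ne_last]
    · simpa using h5
    · funext j
      refine Fin.lastCases ?_ (fun i => ?_) j
      · simp [dualObjective]
      · simp [dualObjective, weight, Fin.castSucc_ne_last]

end Weight

theorem mem_neg_polarCone {q : ℕ} {C : Set (Fin q → ℝ)} {w : Fin q → ℝ} :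
    w ∈ -polarCone C ↔ ∀ y ∈ C, 0 ≤ w ⬝ᵥ y := by
  simp [polarCone]

/-- By Farkas' lemma `-C°` is the cone generated by the columns of `Z`, a projection of a
polyhedron. -/
theorem IsPolyhedralCone.isPolyhedron_neg_polarCone {q : ℕ} {C : Set (Fin q → ℝ)}
    (hC : IsPolyhedralCone C) : IsPolyhedron (-polarCone C) := by
  obtain ⟨r, Z, rfl⟩ := hC
  have hpoly : IsPolyhedron {w : Fin q → ℝ | ∃ t : Fin r → ℝ, (w, t) ∈
      {p : (Fin q → ℝ) × (Fin r → ℝ) | 0 ≤ LinearMap.snd ℝ (Fin q → ℝ) (Fin r → ℝ) p} ∩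
      {p | (Z.mulVecLin ∘ₗ LinearMap.snd ℝ (Fin q → ℝ) (Fin r → ℝ) -
        LinearMap.fst ℝ (Fin q → ℝ) (Fin r → ℝ)) p = 0}} :=
    ((IsPolyhedron.le_pi _ _).inter (IsPolyhedron.eq _)).exists_pi
  convert hpoly using 1
  ext w
  simp only [mem_neg_polarCone, Set.mem_inter_iff, Set.mem_ofPred_eq, LinearMap.snd_apply,
    LinearMap.sub_apply, LinearMap.comp_apply, LinearMap.fst_apply, Matrix.mulVecLin_apply,
    sub_eq_zero]
  constructor
  · intro h
    obtain ⟨t, ht, hsum⟩ := farkas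
      (fun i => LinearMap.proj i ∘ₗ Zᵀ.mulVecLin) (dotProductEquiv ℝ (Fin q) w) fun y hy => h y hy
    refine ⟨t, ht, funext fun j => ?_⟩
    have := LinearMap.congr_fun hsum (Pi.single j 1)
    simpa [Matrix.mulVec, dotProduct, Pi.single_apply, mul_comm] using this
  · rintro ⟨t, ht, rfl⟩ y hy
    rw [dotProduct_comm, Matrix.dotProduct_mulVec, ← Matrix.mulVec_transpose]
    exact dotProduct_nonneg_of_nonneg hy ht

section Images

variable {m n d : ℕ} {A : Matrix (Fin m) (Fin n) ℝ} {b : Fin m → ℝ}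
  {P : Matrix (Fin (d + 1)) (Fin n) ℝ} {C : Set (Fin (d + 1) → ℝ)} {c : Fin (d + 1) → ℝ}

theorem IsPolyhedralCone.smul_add_mem {q : ℕ} {C : Set (Fin q → ℝ)} (hC : IsPolyhedralCone C)
    {x y : Fin q → ℝ} (hx : x ∈ C) (hy : y ∈ C) {t : ℝ} (ht : 0 ≤ t) : x + t • y ∈ C := by
  obtain ⟨r, Z, rfl⟩ := hC
  simp only [Set.mem_ofPred_eq, Matrix.mulVec_add, Matrix.mulVec_smul] at *
  exact add_nonneg hx (smul_nonneg ht hy)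

theorem IsPolyhedralCone.zero_mem {q : ℕ} {C : Set (Fin q → ℝ)} (hC : IsPolyhedralCone C) :
    0 ∈ C := by
  obtain ⟨r, Z, rfl⟩ := hC
  simp

theorem isPolyhedron_upperImage (hC : IsPolyhedralCone C) :
    IsPolyhedron (upperImage A b P C) := by
  obtain ⟨r, Z, rfl⟩ := hC
  let E := Fin (d + 1) → ℝ
  have hpoly : IsPolyhedron {y : E | ∃ x : Fin n → ℝ, (y, x) ∈
      {p : E × (Fin n → ℝ) | b ≤ (A.mulVecLin ∘ₗ LinearMap.snd ℝ E (Fin n → ℝ)) p} ∩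
      {p | 0 ≤ (Zᵀ.mulVecLin ∘ₗ (LinearMap.fst ℝ E (Fin n → ℝ) -
        P.mulVecLin ∘ₗ LinearMap.snd ℝ E (Fin n → ℝ))) p}} :=
    ((IsPolyhedron.le_pi _ _).inter (IsPolyhedron.le_pi _ _)).exists_pi
  convert hpoly using 1
  ext y
  constructor
  · rintro ⟨_, ⟨x, hx, rfl⟩, k, hk, rfl⟩
    refine ⟨x, hx, ?_⟩
    simp only [Set.mem_ofPred_eq, LinearMap.comp_apply, LinearMap.sub_apply, LinearMap.fst_apply,
      LinearMap.snd_apply, Matrix.mulVecLin_apply, add_sub_cancel_left]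
    exact hk
  · rintro ⟨x, hx, hk⟩
    exact ⟨_, ⟨x, hx, rfl⟩, y - P *ᵥ x, hk, by simp⟩

theorem isPolyhedron_lowerImage (hC : IsPolyhedralCone C) (hc : c (Fin.last d) = 1) :
    IsPolyhedron (lowerImage A b P C c) := by
  have hpoly : IsPolyhedron ({p : ((Fin (d + 1) → ℝ) × ℝ) | ∃ u : Fin m → ℝ, (p, u) ∈
      ({p : ((Fin (d + 1) → ℝ) × ℝ) × (Fin m → ℝ) | 0 ≤ LinearMap.snd ℝ ((Fin (d + 1) → ℝ) × ℝ) (Fin m → ℝ) p} ∩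
      {p | (Aᵀ.mulVecLin ∘ₗ LinearMap.snd ℝ ((Fin (d + 1) → ℝ) × ℝ) (Fin m → ℝ) -
        Pᵀ.mulVecLin ∘ₗ LinearMap.fst ℝ (Fin (d + 1) → ℝ) ℝ ∘ₗ LinearMap.fst ℝ ((Fin (d + 1) → ℝ) × ℝ) (Fin m → ℝ)) p
          = 0}) ∩
      {p | 0 ≤ (dotProductEquiv ℝ (Fin m) b ∘ₗ LinearMap.snd ℝ ((Fin (d + 1) → ℝ) × ℝ) (Fin m → ℝ) -
        LinearMap.snd ℝ (Fin (d + 1) → ℝ) ℝ ∘ₗ LinearMap.fst ℝ ((Fin (d + 1) → ℝ) × ℝ) (Fin m → ℝ)) p}} ∩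
      LinearMap.fst ℝ (Fin (d + 1) → ℝ) ℝ ⁻¹' (-polarCone C)) :=
    (((IsPolyhedron.le_pi _ _).inter (IsPolyhedron.eq _)).inter
      (IsPolyhedron.halfspace _ _)).exists_pi.inter
        (hC.isPolyhedron_neg_polarCone.preimage_linear _)
  -- Linear part of the affine map `v ↦ (weight c v, v_q)`, along which the polyhedron is pulled
  -- back.
  let lin : (Fin (d + 1) → ℝ) →ₗ[ℝ] ((Fin (d + 1) → ℝ) × ℝ) :=
    (LinearMap.pi (Fin.snoc (α := fun _ => Module.Dual ℝ (Fin (d + 1) → ℝ))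
      (fun i : Fin d => LinearMap.proj i.castSucc)
      (-∑ i : Fin d, c i.castSucc • LinearMap.proj i.castSucc))).prod
      (LinearMap.proj (Fin.last d))
  have hlin : ∀ v, lin v + (Pi.single (Fin.last d) 1, 0) = (weight c v, v (Fin.last d)) := by
    intro v
    refine Prod.ext (funext fun j => ?_) (by simp [lin])
    refine Fin.lastCases ?_ (fun i => ?_) j
    · simp [lin, weight]
      ring
    · simp [lin, weight, Fin.castSucc_ne_last]
  convert hpoly.preimage lin (Pi.single (Fin.last d) 1, 0) using 1
  ext v
  simp only [mem_lowerImage_iff hc, hlin, Set.mem_ofPred_eq, Set.mem_inter_iff, Set.mem_preimage,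
    LinearMap.sub_apply, LinearMap.comp_apply, LinearMap.fst_apply, LinearMap.snd_apply,
    Matrix.mulVecLin_apply, sub_eq_zero, dotProductEquiv_apply_apply,
    sub_nonneg, and_assoc]
  exact and_comm

/-- Weak duality gives one inclusion. Conversely, letting the `C` component grow forces the weight
into `-C°`, and `affine_farkas` over the feasible set supplies `u`. -/
theorem lowerImage_eq_polar (hC : IsPolyhedralCone C) (hS : (feasibleSet A b).Nonempty)
    (hc : c (Fin.last d) = 1) :
    lowerImage A b P C c = (geometricCoupling c hc).polar (upperImage A b P C) := by
  ext v
  simp only [mem_lowerImage_iff hc, Coupling.polar, Set.mem_ofPred_eq, geometricCoupling_val,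
    coupling_eq_weight, mem_neg_polarCone, sub_nonneg]
  constructor
  · rintro ⟨hw, u, hu, hAu, hbu⟩ _ ⟨_, ⟨x, hx, rfl⟩, k, hk, rfl⟩
    have h1 : b ⬝ᵥ u ≤ (A *ᵥ x) ⬝ᵥ u := dotProduct_le_dotProduct_of_nonneg_right hx hu
    have h2 : (A *ᵥ x) ⬝ᵥ u = weight c v ⬝ᵥ (P *ᵥ x) := by
      rw [dotProduct_comm, Matrix.dotProduct_mulVec, ← Matrix.mulVec_transpose, hAu,
        Matrix.mulVec_transpose, ← Matrix.dotProduct_mulVec]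
    rw [dotProduct_add]
    linarith [hw k hk]
  · intro h
    obtain ⟨x₀, hx₀⟩ := hS
    have hmem : ∀ x ∈ feasibleSet A b, ∀ k ∈ C,
        v (Fin.last d) ≤ weight c v ⬝ᵥ (P *ᵥ x) + weight c v ⬝ᵥ k := fun x hx k hk => by
      rw [← dotProduct_add]
      exact h _ (Set.add_mem_add ⟨x, hx, rfl⟩ hk)
    refine ⟨fun k hk => ?_, ?_⟩
    · by_contra! hneg
      -- `k` is scaled so that the weight takes the value `-(s + 1)` on it, which brings the bound
      -- at `x₀` to one below `v_q`.
      set s := weight c v ⬝ᵥ (P *ᵥ x₀) - v (Fin.last d) with hs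
      have hs0 : 0 ≤ s := by simpa [hs] using hmem x₀ hx₀ 0 hC.zero_mem
      have := hmem x₀ hx₀ _ (hC.smul_add_mem hC.zero_mem hk
        (div_nonneg_of_nonpos (by linarith : -(s + 1) ≤ 0) hneg.le))
      rw [zero_add, dotProduct_smul, smul_eq_mul, div_mul_cancel₀ _ hneg.ne] at this
      linarith
    · obtain ⟨u, hu, hsum, hb⟩ := affine_farkas (fun i => LinearMap.proj i ∘ₗ A.mulVecLin) b
        (dotProductEquiv ℝ (Fin n) (Pᵀ *ᵥ weight c v)) (v (Fin.last d)) hx₀ fun x hx => by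
          have := hmem x hx 0 hC.zero_mem
          simpa [Matrix.mulVec_transpose, ← Matrix.dotProduct_mulVec] using this
      refine ⟨u, hu, funext fun j => ?_, by simpa [dotProduct, mul_comm] using hb⟩
      have := LinearMap.congr_fun hsum (Pi.single j 1)
      simpa [Matrix.mulVec, dotProduct, Pi.single_apply, mul_comm] using this

end Images

/-! ### Translation to the coupling and the duality theorem -/

theorem neg_dualOrderingCone {d : ℕ} (c : Fin (d + 1) → ℝ) (hc : c (Fin.last d) = 1) :
    -dualOrderingCone d = coneHull {(geometricCoupling c hc).e'} := by
  ext v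
  simp only [mem_coneHull_singleton, Set.mem_neg, dualOrderingCone, Set.mem_ofPred_eq,
    geometricCoupling, Pi.neg_apply, neg_eq_zero]
  constructor
  · rintro ⟨h1, h2⟩
    refine ⟨_, h2, funext fun j => ?_⟩
    refine Fin.lastCases (by simp) (fun i => ?_) j
    simp [h1, Fin.castSucc_ne_last]
  · rintro ⟨r, hr, rfl⟩
    simpa [Fin.castSucc_ne_last] using hr

theorem maximalProperFaces_eq {d : ℕ} (c : Fin (d + 1) → ℝ) (hc : c (Fin.last d) = 1)
    (L : Set (Fin (d + 1) → ℝ)) : maximalProperFaces (dualOrderingCone d) L =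
      minimalProperFaces (coneHull {(geometricCoupling c hc).e'}) L := by
  rw [← neg_dualOrderingCone c hc]
  rfl

theorem dualityMap_eq_conj {d : ℕ} (c : Fin (d + 1) → ℝ) (hc : c (Fin.last d) = 1)
    {U F : Set (Fin (d + 1) → ℝ)} (hF : F.Nonempty) :
    dualityMap c U F = (geometricCoupling c hc).flip.conj U F := by
  obtain ⟨v, hv⟩ := hF
  ext y
  simp only [dualityMap, Coupling.conj, Set.mem_iInter, Set.mem_ofPred_eq, Coupling.flip_val,
    geometricCoupling_val]
  exact ⟨fun h => ⟨(h v hv).1, fun w hw => (h w hw).2⟩, fun h w hw => ⟨h.1, h.2 w hw⟩⟩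

theorem inverseDualityMap_eq_conj {d : ℕ} (c : Fin (d + 1) → ℝ) (hc : c (Fin.last d) = 1)
    {L F : Set (Fin (d + 1) → ℝ)} (hF : F.Nonempty) :
    inverseDualityMap c L F = (geometricCoupling c hc).conj L F := by
  obtain ⟨y, hy⟩ := hF
  ext v
  simp only [inverseDualityMap, Coupling.conj, Set.mem_iInter, Set.mem_ofPred_eq,
    geometricCoupling_val]
  exact ⟨fun h => ⟨(h y hy).1, fun w hw => (h w hw).2⟩, fun h w hw => ⟨h.1, h.2 w hw⟩⟩

end GeometricDuality

/-- Geometric duality theorem for the linear vector optimization problem `min_C P x` subject to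
`A x ≥ b` with image space of dimension `q = d + 1`. -/
theorem theorem1 {m n d : ℕ}
    (A : Matrix (Fin m) (Fin n) ℝ) (b : Fin m → ℝ) (P : Matrix (Fin (d + 1)) (Fin n) ℝ)
    (hS : (GeometricDuality.feasibleSet A b).Nonempty)
    (C : Set (Fin (d + 1) → ℝ)) (hC : GeometricDuality.IsPolyhedralCone C)
    (hCpointed : GeometricDuality.IsPointed C) (hCnontrivial : C ≠ {0})
    (c : Fin (d + 1) → ℝ) (hc : c ∈ intrinsicInterior ℝ C) (hc_last : c (Fin.last d) = 1)
    (U : Set (Fin (d + 1) → ℝ)) (hU : U = GeometricDuality.upperImage A b P C)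
    (L : Set (Fin (d + 1) → ℝ)) (hL : L = GeometricDuality.lowerImage A b P C c)
    (R : Set (Fin (d + 1) → ℝ)) (hR : R = GeometricDuality.coneHull {c})
    (Rs : Set (Fin (d + 1) → ℝ)) (hRs : Rs = GeometricDuality.dualOrderingCone d) :
    Set.BijOn (GeometricDuality.dualityMap c U)
        (GeometricDuality.maximalProperFaces Rs L) (GeometricDuality.minimalProperFaces R U) ∧
      (∀ F₁ ∈ GeometricDuality.maximalProperFaces Rs L,
        ∀ F₂ ∈ GeometricDuality.maximalProperFaces Rs L,
          F₁ ⊆ F₂ ↔ GeometricDuality.dualityMap c U F₂ ⊆ GeometricDuality.dualityMap c U F₁) ∧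
      Set.InvOn (GeometricDuality.inverseDualityMap c L) (GeometricDuality.dualityMap c U)
        (GeometricDuality.maximalProperFaces Rs L) (GeometricDuality.minimalProperFaces R U) ∧
      (∀ F ∈ GeometricDuality.maximalProperFaces Rs L,
        GeometricDuality.dim F
          + GeometricDuality.dim (GeometricDuality.dualityMap c U F) = d) := by
  have hcC : c ∈ C := intrinsicInterior_subset hc
  subst hR hRs
  let K := GeometricDuality.geometricCoupling c hc_last
  have hUpoly : GeometricDuality.IsPolyhedron U := hU ▸ GeometricDuality.isPolyhedron_upperImage hC
  have hLpoly : GeometricDuality.IsPolyhedron L :=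
    hL ▸ GeometricDuality.isPolyhedron_lowerImage hC hc_last
  have hLU : L = K.polar U := by
    rw [hL, hU]
    exact GeometricDuality.lowerImage_eq_polar hC hS hc_last
  have hUne : U.Nonempty := by
    rw [hU]
    exact Set.Nonempty.add (hS.image _) ⟨0, hC.zero_mem⟩
  have hUrec : ∀ y ∈ U, ∀ t : ℝ, 0 ≤ t → y + t • K.e ∈ U := by
    rw [hU]
    rintro _ ⟨a, ha, k, hk, rfl⟩ t ht
    exact ⟨a, ha, k + t • c, hC.smul_add_mem hk hcC ht, (add_assoc _ _ _).symm⟩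
  have hLrec : ∀ v ∈ L, ∀ t : ℝ, 0 ≤ t → v + t • K.flip.e ∈ L := by
    rw [hLU]
    intro v hv t ht y hy
    rw [show K.flip.e = K.e' from rfl, K.val_add_smul_e']
    exact add_nonneg (hv y hy) ht
  rw [GeometricDuality.maximalProperFaces_eq c hc_last]
  have hdown : ∀ F ∈ GeometricDuality.minimalProperFaces (GeometricDuality.coneHull {c}) U,
      GeometricDuality.inverseDualityMap c L F ∈
        GeometricDuality.minimalProperFaces (GeometricDuality.coneHull {K.e'}) L ∧
      GeometricDuality.dualityMap c U (GeometricDuality.inverseDualityMap c L F) = F := by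
    intro F hF
    obtain ⟨h1, h2, -⟩ := K.conj_minimalProperFace hUpoly hUrec hF
    rw [← hLU] at h1 h2
    rw [GeometricDuality.inverseDualityMap_eq_conj c hc_last hF.1.2.1,
      GeometricDuality.dualityMap_eq_conj c hc_last h1.1.2.1]
    exact ⟨h1, h2⟩
  have hup : ∀ G ∈ GeometricDuality.minimalProperFaces (GeometricDuality.coneHull {K.e'}) L,
      GeometricDuality.dualityMap c U G ∈
        GeometricDuality.minimalProperFaces (GeometricDuality.coneHull {c}) U ∧
      GeometricDuality.inverseDualityMap c L (GeometricDuality.dualityMap c U G) = G ∧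
      GeometricDuality.dim G + GeometricDuality.dim (GeometricDuality.dualityMap c U G) = d := by
    intro G hG
    -- The bipolar identity needs a nonempty polar; the nonempty face `G` of `L` guarantees it.
    have hLne : (K.polar U).Nonempty := hLU ▸ hG.1.2.1.mono hG.1.1.2.subset
    have hUL : K.flip.polar L = U := by
      rw [hLU]
      exact K.polar_polar hUpoly hUne hUrec hLne
    obtain ⟨h1, h2, h3⟩ := K.flip.conj_minimalProperFace hLpoly hLrec hG
    rw [hUL] at h1 h2 h3
    rw [GeometricDuality.dualityMap_eq_conj c hc_last hG.1.2.1,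
      GeometricDuality.inverseDualityMap_eq_conj c hc_last h1.1.2.1]
    exact ⟨h1, h2, h3⟩
  have hinv : Set.InvOn (GeometricDuality.inverseDualityMap c L) (GeometricDuality.dualityMap c U)
      (GeometricDuality.minimalProperFaces (GeometricDuality.coneHull {K.e'}) L)
      (GeometricDuality.minimalProperFaces (GeometricDuality.coneHull {c}) U) :=
    ⟨fun G hG => (hup G hG).2.1, fun F hF => (hdown F hF).2⟩
  refine ⟨hinv.bijOn (fun G hG => (hup G hG).1) fun F hF => (hdown F hF).1,
    fun F₁ h₁ F₂ h₂ => ⟨fun h => Set.biInter_subset_biInter_left h, fun h => ?_⟩, hinv,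
    fun F hF => (hup F hF).2.2⟩
  -- Both maps are intersections over their argument, hence antitone; applying the inverse turns the
  -- inclusion of images back.
  rw [← (hup F₁ h₁).2.1, ← (hup F₂ h₂).2.1]
  exact Set.biInter_subset_biInter_left h
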